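/- **Setting.** Equip $\mathbb{R}^n$ with the Euclidean norm and inner product; let $\mathbb{B}^n$ be its closed unit ball. Let $\mathcal{I}$ be the set of closed bounded intervals $[\underline q,\overline q]$, $\underline q\le\overline q$, in $\mathbb{R}$, with endpointwise addition. For $Q=[\underline q,\overline q]\in\mathcal I$ put $q^c=\frac{\underline q+\overline q}{2}$, $q^w=\frac{\overline q-\underline q}{2}$, and write $Q\prec_{CW}R$ if $q^c<r^c$ and $q^w<r^w$. Let $F_k:\mathbb{R}^n\to\mathcal I$, $F_k(u)=[\underline F_k(u),\overline F_k(u)]$, $k\in K=\{1,\dots,m\}$, and $g_j:\mathbb{R}^n\to\mathbb{R}$, $j\in J=\{1,\dots,p\}$, be locally Lipschitz continuous; for $F_k$ this means that every point has a neighbourhood $U$ and an $L>0$ with $\max\{|\underline F_k(u_1)-\underline F_k(u_2)|,|\overline F_k(u_1)-\overline F_k(u_2)|\}\le L\|u_1-u_2\|$ for all $u_1,u_2\in U$. Let $S=\{u\in\mathbb{R}^n: g_j(u)\le 0\ \forall j\in J\}$ and $I(u)=\{j\in J: g_j(u)=0\}$. For $\varepsilon\in\mathbb{R}^m_+$, $M(F,S,\varepsilon)$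 is the set of weak $\varepsilon$-minimal solutions: the points $u\in S$ for which there is no $z\in S$ with $F_k(z)+[0,\varepsilon_k]\prec_{CW}F_k(u)$ for all $k\in K$. For a locally Lipschitz $\psi:\mathbb{R}^n\to\mathbb{R}$ let $\psi^0(z;w)=\limsup_{u\to z,\,t\to0^+}\frac{\psi(u+tw)-\psi(u)}{t}$ and let $\partial^0\psi(z)=\{\xi\in\mathbb{R}^n:\langle\xi,w\rangle\le\psi^0(z;w)\ \forall w\in\mathbb{R}^n\}$ be the Clarke generalized gradient. For the interval-valued $F_k$, with $F_k^c$ and $F_k^w$ the center and width functions of $F_k$, let $\partial^0F_k(u)=\mathrm{co}\big(\partial^0F_k^c(u)\cup\partial^0F_k^w(u)\big)$. The basic constraint qualification (BCQ) holds at $u\in S$ if there is no $\mu\in\mathbb{R}^p_+\setminus\{0\}$ with $\mu_j=0$ for all $j\notin I(u)$ and $0\in\sum_{j\in J}\mu_j\,\partial^0g_j(u)$. For $\bar u\in S$ and $\delta>0$ let $\overline B(\bar u,\delta)=\{z\in S:\|z-\bar u\|\le\delta\}$. **Theorem 4.1.** Let $\varepsilon\in\mathbb{R}^m_+\setminus\{0\}$,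 $\bar u\in M(F,S,\varepsilon)$ and $\delta>0$, and assume that BCQ holds at every point of $\overline B(\bar u,\delta)$. Then there exist $x_\delta\in\overline B(\bar u,\delta)$, $\lambda\in\mathbb{R}^m_+$ with $\sum_{k\in K}\lambda_k=1$, and $\mu\in\mathbb{R}^p_+$ such that $$0\in\sum_{k\in K}\lambda_k\,\partial^0F_k(x_\delta)+\sum_{j\in I(x_\delta)}\mu_j\,\partial^0g_j(x_\delta)+\frac1\delta\max_{k\in K}\{\varepsilon_k\}\,\mathbb{B}^n$$ and $\mu_jg_j(x_\delta)=0$ for all $j\in J$. -/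

import Mathlib

open scoped NNReal Pointwise Topology

namespace MIOP

/-! ### Closed bounded intervals

The set of all closed and bounded real intervals `[q, r]`, `q ≤ r`, is `NonemptyInterval ℝ`.
Its addition in Mathlib is endpointwise, and `Q - P` in Mathlib is `Q + (-1)P`. -/

/-- The center `q^c` of an interval. -/
noncomputable def center (Q : NonemptyInterval ℝ) : ℝ := (Q.fst + Q.snd) / 2

/-- The (half-)width `q^w` of an interval. -/
noncomputable def width (Q : NonemptyInterval ℝ) : ℝ := (Q.snd - Q.fst) / 2

/-- The norm `max {|q|, |r|}` of the interval `[q, r]`. -/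
noncomputable def intervalNorm (Q : NonemptyInterval ℝ) : ℝ := max |Q.fst| |Q.snd|

/-- The generalized Hukuhara difference of two intervals, by its explicit formula;
see `gHDiff_eq_iff` for the defining property. -/
noncomputable def gHDiff (Q R : NonemptyInterval ℝ) : NonemptyInterval ℝ :=
  ⟨(min (Q.fst - R.fst) (Q.snd - R.snd), max (Q.fst - R.fst) (Q.snd - R.snd)), min_le_max⟩

theorem gHDiff_eq_iff (Q R P : NonemptyInterval ℝ) :
    gHDiff Q R = P ↔ Q = R + P ∨ R = Q - P := by
  obtain ⟨⟨a, b⟩, hab⟩ := Q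
  obtain ⟨⟨c, d⟩, hcd⟩ := R
  obtain ⟨⟨e, f⟩, hef⟩ := P
  simp only [NonemptyInterval.ext_iff, Prod.ext_iff, gHDiff, NonemptyInterval.fst_add,
    NonemptyInterval.snd_add, NonemptyInterval.fst_sub, NonemptyInterval.snd_sub] at *
  grind

/-- The strict center-width order on intervals. -/
def StrictCW (Q R : NonemptyInterval ℝ) : Prop := center Q < center R ∧ width Q < width R

/-- The interval `[0, e]` for `e ≥ 0`. -/
def zeroTo (e : ℝ≥0) : NonemptyInterval ℝ := ⟨(0, (e : ℝ)), e.2⟩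

/-! ### Interval-valued functions and the Clarke generalized gradient -/

variable {n m p : ℕ}

/-- Local Lipschitz continuity of an interval-valued function. -/
def LocallyLipschitzIVF (f : EuclideanSpace ℝ (Fin n) → NonemptyInterval ℝ) : Prop :=
  ∀ u₀, ∃ U ∈ 𝓝 u₀, ∃ L : ℝ, 0 < L ∧
    ∀ u₁ ∈ U, ∀ u₂ ∈ U, intervalNorm (gHDiff (f u₁) (f u₂)) ≤ L * ‖u₁ - u₂‖

/-- The Clarke directional derivative of a (locally Lipschitz) function `ψ` at `z` in the
direction `w`: the upper limit of `(ψ (u + t w) - ψ u) / t` as `u → z`, `t → 0+`. The difference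
quotients of a locally Lipschitz function are bounded near `(z, 0)`, so that the real upper limit
is the genuine one. -/
noncomputable def clarkeDeriv (ψ : EuclideanSpace ℝ (Fin n) → ℝ)
    (z w : EuclideanSpace ℝ (Fin n)) : ℝ :=
  Filter.limsup (fun q : EuclideanSpace ℝ (Fin n) × ℝ => (ψ (q.1 + q.2 • w) - ψ q.1) / q.2)
    (𝓝 z ×ˢ 𝓝[>] (0 : ℝ))

/-- The Clarke generalized gradient of a (locally Lipschitz) real-valued function. -/
def clarkeGradient (ψ : EuclideanSpace ℝ (Fin n) → ℝ) (z : EuclideanSpace ℝ (Fin n)) :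
    Set (EuclideanSpace ℝ (Fin n)) :=
  {ξ | ∀ w, inner ℝ ξ w ≤ clarkeDeriv ψ z w}

/-- The weakly generalized gradient of a (locally Lipschitz) interval-valued function `f`: the
convex hull of the union of the Clarke generalized gradients of its center and its width. -/
def weakGradient (f : EuclideanSpace ℝ (Fin n) → NonemptyInterval ℝ)
    (z : EuclideanSpace ℝ (Fin n)) : Set (EuclideanSpace ℝ (Fin n)) :=
  convexHull ℝ
    (clarkeGradient (fun u => center (f u)) z ∪ clarkeGradient (fun u => width (f u)) z)

/-! ### The optimization problem -/

/-- The feasible set `S = {u | g_j(u) ≤ 0 for all j}`. -/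
def feasibleSet (g : Fin p → EuclideanSpace ℝ (Fin n) → ℝ) : Set (EuclideanSpace ℝ (Fin n)) :=
  {u | ∀ j, g j u ≤ 0}

/-- The active index set `I(u) = {j | g_j(u) = 0}`. -/
noncomputable def activeIndices (g : Fin p → EuclideanSpace ℝ (Fin n) → ℝ)
    (u : EuclideanSpace ℝ (Fin n)) : Finset (Fin p) :=
  {j | g j u = 0}

/-- The set `M(F, S, ε)` of (global) weak `ε`-minimal solutions. -/
def weakEpsMinimal (F : Fin m → EuclideanSpace ℝ (Fin n) → NonemptyInterval ℝ)
    (S : Set (EuclideanSpace ℝ (Fin n))) (ε : Fin m → ℝ≥0) : Set (EuclideanSpace ℝ (Fin n)) :=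
  {u | u ∈ S ∧ ¬ ∃ z ∈ S, ∀ k, StrictCW (F k z + zeroTo (ε k)) (F k u)}

/-- The basic constraint qualification at the point `u`. -/
def BCQ (g : Fin p → EuclideanSpace ℝ (Fin n) → ℝ) (u : EuclideanSpace ℝ (Fin n)) : Prop :=
  ¬ ∃ μ : Fin p → ℝ, μ ≠ 0 ∧ (∀ j, 0 ≤ μ j) ∧ (∀ j, j ∉ activeIndices g u → μ j = 0) ∧
    0 ∈ ∑ j, μ j • clarkeGradient (g j) u

/-- The closed ball of radius `δ` around `u`, relative to `S`. -/
def ballIn (S : Set (EuclideanSpace ℝ (Fin n))) (u : EuclideanSpace ℝ (Fin n)) (δ : ℝ) :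
    Set (EuclideanSpace ℝ (Fin n)) :=
  {z | z ∈ S ∧ ‖z - u‖ ≤ δ}

end MIOP

namespace MIOP

open Filter

/-! ### Clarke derivatives and gradients. -/

section ClarkeCalculus

variable {n : ℕ} {ψ : EuclideanSpace ℝ (Fin n) → ℝ}

/-! Let φ(z) be the largest of the 2m increments of center and width from ū to z, each shifted by
ε_k/2, which is both the center and the width of [0, ε_k]. Weak ε-minimality says that φ ≥ 0 on S,
while φ(ū) ≤ e/2 with e = max ε_k. A quadratic penalty then plays the role of Ekeland's principle
(`exists_local_min_add_sq`): with κ = e/(2δ²), φ + κ‖· - ū‖² has a local minimizer x on S within δ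
of ū, and the penalty gradient v = 2κ(x - ū) has norm at most e/δ, the radius wanted.

At x, no direction w makes ψ⁰(x; w) + ⟨v, w⟩ negative for all objectives and ψ⁰(x; w) negative for
all active constraints (`exists_no_common_descent`). Since ψ⁰ is the support function of the
gradient, separation yields a vanishing convex combination of gradients, those of the objectives
shifted by v (`exists_stdSimplex_clarkeGradient`). BCQ forbids zero total weight on the objectives,
and dividing by that weight leaves v with coefficient one (`exists_kkt_of_fritzJohn`). -/

theorem tendsto_add_smul (z w : EuclideanSpace ℝ (Fin n)) :
    Tendsto (fun q : EuclideanSpace ℝ (Fin n) × ℝ => q.1 + q.2 • w)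
      (𝓝 z ×ˢ 𝓝[>] (0 : ℝ)) (𝓝 z) := by
  have h : Tendsto (fun q : EuclideanSpace ℝ (Fin n) × ℝ => q.1 + q.2 • w)
      (𝓝 z ×ˢ 𝓝 (0 : ℝ)) (𝓝 (z + (0 : ℝ) • w)) := by
    rw [← nhds_prod_eq]
    exact Continuous.tendsto (f := fun q : EuclideanSpace ℝ (Fin n) × ℝ => q.1 + q.2 • w)
      (by fun_prop) (z, 0)
  rw [zero_smul, add_zero] at h
  exact h.mono_left (prod_mono le_rfl nhdsWithin_le_nhds)

theorem eventually_pos_snd (z : EuclideanSpace ℝ (Fin n)) :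
    ∀ᶠ q : EuclideanSpace ℝ (Fin n) × ℝ in 𝓝 z ×ˢ 𝓝[>] (0 : ℝ), 0 < q.2 :=
  tendsto_snd.eventually (self_mem_nhdsWithin : Set.Ioi (0 : ℝ) ∈ 𝓝[>] (0 : ℝ))

/-- The difference quotients of a locally Lipschitz function are bounded near a point,
with a bound that is linear in the norm of the direction. -/
theorem exists_eventually_abs_quotient_le (hψ : LocallyLipschitz ψ)
    (z : EuclideanSpace ℝ (Fin n)) :
    ∃ K : ℝ, ∀ w, ∀ᶠ q : EuclideanSpace ℝ (Fin n) × ℝ in 𝓝 z ×ˢ 𝓝[>] (0 : ℝ),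
      |(ψ (q.1 + q.2 • w) - ψ q.1) / q.2| ≤ K * ‖w‖ := by
  obtain ⟨K, t, ht, hK⟩ := hψ z
  refine ⟨K, fun w => ?_⟩
  filter_upwards [eventually_pos_snd z, tendsto_add_smul z w ht, tendsto_fst ht] with q h0 h1 h2
  have h := hK.dist_le_mul _ h1 _ h2
  rw [Real.dist_eq, dist_eq_norm, add_sub_cancel_left, norm_smul, Real.norm_eq_abs,
    abs_of_pos h0] at h
  rw [abs_div, abs_of_pos h0, div_le_iff₀ h0]
  linarith

theorem isBoundedUnder_quotient (hψ : LocallyLipschitz ψ) (z w : EuclideanSpace ℝ (Fin n)) :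
    IsBoundedUnder (· ≤ ·) (𝓝 z ×ˢ 𝓝[>] (0 : ℝ))
      (fun q : EuclideanSpace ℝ (Fin n) × ℝ => (ψ (q.1 + q.2 • w) - ψ q.1) / q.2) := by
  obtain ⟨K, hK⟩ := exists_eventually_abs_quotient_le hψ z
  exact isBoundedUnder_of_eventually_le ((hK w).mono fun q hq => (abs_le.1 hq).2)

theorem isCoboundedUnder_quotient (hψ : LocallyLipschitz ψ) (z w : EuclideanSpace ℝ (Fin n)) :
    IsCoboundedUnder (· ≤ ·) (𝓝 z ×ˢ 𝓝[>] (0 : ℝ))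
      (fun q : EuclideanSpace ℝ (Fin n) × ℝ => (ψ (q.1 + q.2 • w) - ψ q.1) / q.2) := by
  obtain ⟨K, hK⟩ := exists_eventually_abs_quotient_le hψ z
  exact isCoboundedUnder_le_of_eventually_le _ ((hK w).mono fun q hq => (abs_le.1 hq).1)

theorem eventually_quotient_lt (hψ : LocallyLipschitz ψ) {z w : EuclideanSpace ℝ (Fin n)} {b : ℝ}
    (h : clarkeDeriv ψ z w < b) :
    ∀ᶠ q : EuclideanSpace ℝ (Fin n) × ℝ in 𝓝 z ×ˢ 𝓝[>] (0 : ℝ),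
      (ψ (q.1 + q.2 • w) - ψ q.1) / q.2 < b :=
  eventually_lt_of_limsup_lt h (isBoundedUnder_quotient hψ z w)

theorem clarkeDeriv_le_of_eventually (hψ : LocallyLipschitz ψ) {z w : EuclideanSpace ℝ (Fin n)}
    {b : ℝ} (h : ∀ᶠ q : EuclideanSpace ℝ (Fin n) × ℝ in 𝓝 z ×ˢ 𝓝[>] (0 : ℝ),
      (ψ (q.1 + q.2 • w) - ψ q.1) / q.2 ≤ b) : clarkeDeriv ψ z w ≤ b :=
  limsup_le_of_le (isCoboundedUnder_quotient hψ z w) h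

theorem clarkeDeriv_zero (z : EuclideanSpace ℝ (Fin n)) : clarkeDeriv ψ z 0 = 0 := by
  simp [clarkeDeriv]

/-- The upper limit lets the base point vary: the second leg of the quotient starts at u + t w₁,
which still tends to z. -/
theorem clarkeDeriv_add_le (hψ : LocallyLipschitz ψ) (z w₁ w₂ : EuclideanSpace ℝ (Fin n)) :
    clarkeDeriv ψ z (w₁ + w₂) ≤ clarkeDeriv ψ z w₁ + clarkeDeriv ψ z w₂ := by
  refine le_of_forall_pos_le_add fun η hη => clarkeDeriv_le_of_eventually hψ ?_
  have h1 := eventually_quotient_lt hψ (lt_add_of_pos_right (clarkeDeriv ψ z w₁) (half_pos hη))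
  have h2 := ((tendsto_add_smul z w₁).prodMk tendsto_snd).eventually
    (eventually_quotient_lt hψ (lt_add_of_pos_right (clarkeDeriv ψ z w₂) (half_pos hη)))
  filter_upwards [h1, h2] with q h1 h2
  have : (ψ (q.1 + q.2 • (w₁ + w₂)) - ψ q.1) / q.2 =
      (ψ (q.1 + q.2 • w₁) - ψ q.1) / q.2 +
        (ψ (q.1 + q.2 • w₁ + q.2 • w₂) - ψ (q.1 + q.2 • w₁)) / q.2 := by
    rw [smul_add, ← add_assoc]
    ring
  linarith

theorem clarkeDeriv_smul_le (hψ : LocallyLipschitz ψ) (z w : EuclideanSpace ℝ (Fin n)) {c : ℝ}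
    (hc : 0 < c) : clarkeDeriv ψ z (c • w) ≤ c * clarkeDeriv ψ z w := by
  refine le_of_forall_pos_le_add fun η hη => clarkeDeriv_le_of_eventually hψ ?_
  have hT : Tendsto (fun t : ℝ => t * c) (𝓝[>] 0) (𝓝[>] 0) := by
    refine tendsto_nhdsWithin_iff.2 ⟨?_, ?_⟩
    · have : Tendsto (fun t : ℝ => t * c) (𝓝 0) (𝓝 (0 * c)) := tendsto_id.mul_const c
      rw [zero_mul] at this
      exact this.mono_left nhdsWithin_le_nhds
    · filter_upwards [self_mem_nhdsWithin] with t ht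
      exact mul_pos ht hc
  have h1 := (tendsto_fst.prodMk (hT.comp tendsto_snd)).eventually
    (eventually_quotient_lt hψ (lt_add_of_pos_right (clarkeDeriv ψ z w) (div_pos hη hc)))
  filter_upwards [h1, eventually_pos_snd z] with q h1 h0
  simp only [Function.comp_apply, mul_smul] at h1
  rw [div_lt_iff₀ (mul_pos h0 hc)] at h1
  rw [div_le_iff₀ h0]
  refine h1.le.trans (le_of_eq ?_)
  field_simp

theorem clarkeDeriv_smul (hψ : LocallyLipschitz ψ) (z w : EuclideanSpace ℝ (Fin n)) {c : ℝ}
    (hc : 0 < c) : clarkeDeriv ψ z (c • w) = c * clarkeDeriv ψ z w := by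
  refine le_antisymm (clarkeDeriv_smul_le hψ z w hc) ?_
  have h := clarkeDeriv_smul_le hψ z (c • w) (inv_pos.2 hc)
  rw [smul_smul, inv_mul_cancel₀ hc.ne', one_smul] at h
  calc c * clarkeDeriv ψ z w ≤ c * (c⁻¹ * clarkeDeriv ψ z (c • w)) := by gcongr
    _ = clarkeDeriv ψ z (c • w) := by field_simp

/-- The Clarke directional derivative is the support function of the Clarke gradient. -/
theorem exists_mem_clarkeGradient_inner_eq (hψ : LocallyLipschitz ψ)
    (z w : EuclideanSpace ℝ (Fin n)) :
    ∃ ξ ∈ clarkeGradient ψ z, inner ℝ ξ w = clarkeDeriv ψ z w := by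
  have hw : ∀ c : ℝ, c • w = 0 → c • clarkeDeriv ψ z w = 0 := by
    intro c hc
    rcases smul_eq_zero.1 hc with rfl | rfl
    · simp
    · simp [clarkeDeriv_zero]
  -- Hahn–Banach extends c • w ↦ c ψ⁰(z; w) from the line through w. For c < 0, domination follows
  -- from 0 = ψ⁰(z; 0) ≤ ψ⁰(z; c w) + ψ⁰(z; -c w).
  obtain ⟨f, hf, hle⟩ := exists_extension_of_le_sublinear
    (LinearPMap.mkSpanSingleton' w (clarkeDeriv ψ z w) hw) (clarkeDeriv ψ z)
    (fun c hc x => clarkeDeriv_smul hψ z x hc) (clarkeDeriv_add_le hψ z) (by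
      rintro ⟨x, hx⟩
      obtain ⟨c, rfl⟩ := Submodule.mem_span_singleton.1 hx
      rw [LinearPMap.mkSpanSingleton'_apply, RingHom.id_apply, smul_eq_mul]
      dsimp only
      rcases lt_trichotomy c 0 with hc | rfl | hc
      · have h1 := clarkeDeriv_add_le hψ z (c • w) ((-c) • w)
        rw [← add_smul, add_neg_cancel, zero_smul, clarkeDeriv_zero,
          clarkeDeriv_smul hψ z w (neg_pos.2 hc)] at h1
        linarith
      · simp [clarkeDeriv_zero]
      · rw [clarkeDeriv_smul hψ z w hc])
  have hin : ∀ x, inner ℝ ((InnerProductSpace.toDual ℝ _).symm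
      (LinearMap.toContinuousLinearMap f)) x = f x := fun x => by
    rw [InnerProductSpace.toDual_symm_apply]
    rfl
  refine ⟨_, fun x => (hin x).trans_le (hle x), (hin w).trans ?_⟩
  exact (hf ⟨w, Submodule.mem_span_singleton_self w⟩).trans
    (LinearPMap.mkSpanSingleton'_apply_self _ _ _ _)

theorem clarkeGradient_nonempty (hψ : LocallyLipschitz ψ) (z : EuclideanSpace ℝ (Fin n)) :
    (clarkeGradient ψ z).Nonempty :=
  let ⟨ξ, hξ, _⟩ := exists_mem_clarkeGradient_inner_eq hψ z 0
  ⟨ξ, hξ⟩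

theorem convex_clarkeGradient (ψ : EuclideanSpace ℝ (Fin n) → ℝ) (z : EuclideanSpace ℝ (Fin n)) :
    Convex ℝ (clarkeGradient ψ z) := by
  intro ξ hξ η hη a b ha hb hab w
  rw [inner_add_left, real_inner_smul_left, real_inner_smul_left]
  calc a * inner ℝ ξ w + b * inner ℝ η w
      ≤ a * clarkeDeriv ψ z w + b * clarkeDeriv ψ z w := by
        gcongr
        exacts [hξ w, hη w]
    _ = clarkeDeriv ψ z w := by rw [← add_mul, hab, one_mul]

theorem isCompact_clarkeGradient (hψ : LocallyLipschitz ψ) (z : EuclideanSpace ℝ (Fin n)) :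
    IsCompact (clarkeGradient ψ z) := by
  refine Metric.isCompact_of_isClosed_isBounded ?_ ?_
  · rw [clarkeGradient, Set.ofPred_forall]
    exact isClosed_iInter fun w => isClosed_le (by fun_prop) continuous_const
  · obtain ⟨K, hK⟩ := exists_eventually_abs_quotient_le hψ z
    refine isBounded_iff_forall_norm_le.2 ⟨max K 0, fun ξ hξ => ?_⟩
    -- Testing ξ on itself gives ‖ξ‖² ≤ K‖ξ‖.
    have h := (hξ ξ).trans
      (clarkeDeriv_le_of_eventually hψ ((hK ξ).mono fun q hq => (abs_le.1 hq).2))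
    rw [real_inner_self_eq_norm_mul_norm] at h
    rcases eq_or_lt_of_le (norm_nonneg ξ) with h0 | h0
    · rw [← h0]
      exact le_max_right _ _
    · exact (le_of_mul_le_mul_right h h0).trans (le_max_left _ _)

/-- A direction of negative Clarke derivative of `ψ + κ ‖· - a‖²` is a descent direction. -/
theorem eventually_add_sq_lt (hψ : LocallyLipschitz ψ) {x w a : EuclideanSpace ℝ (Fin n)} {κ : ℝ}
    (h : clarkeDeriv ψ x w + inner ℝ ((2 * κ) • (x - a)) w < 0) :
    ∀ᶠ t : ℝ in 𝓝[>] 0, ψ (x + t • w) + κ * ‖x + t • w - a‖ ^ 2 < ψ x + κ * ‖x - a‖ ^ 2 := by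
  obtain ⟨b, hb, hb'⟩ := exists_between (lt_neg_iff_add_neg.2 h)
  have hx : Tendsto (fun t : ℝ => (x, t)) (𝓝[>] 0) (𝓝 x ×ˢ 𝓝[>] 0) :=
    tendsto_const_nhds.prodMk tendsto_id
  have h2 : ∀ᶠ t : ℝ in 𝓝[>] 0,
      b + inner ℝ ((2 * κ) • (x - a)) w + t * (κ * ‖w‖ ^ 2) < 0 := by
    have hc : Continuous fun t : ℝ =>
        b + inner ℝ ((2 * κ) • (x - a)) w + t * (κ * ‖w‖ ^ 2) := by fun_prop
    refine nhdsWithin_le_nhds (hc.tendsto 0 |>.eventually_lt_const ?_)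
    linarith
  filter_upwards [hx.eventually (eventually_quotient_lt hψ hb), h2, self_mem_nhdsWithin]
    with t h1 h2 ht
  have ht : 0 < t := ht
  rw [div_lt_iff₀ ht] at h1
  have hn : ‖x + t • w - a‖ ^ 2 = ‖x - a‖ ^ 2 + 2 * (t * inner ℝ (x - a) w) + t ^ 2 * ‖w‖ ^ 2 := by
    rw [add_sub_right_comm, norm_add_sq_real, real_inner_smul_right, norm_smul, mul_pow,
      Real.norm_eq_abs, sq_abs]
  rw [hn]
  rw [real_inner_smul_left] at h2
  nlinarith [mul_neg_of_pos_of_neg ht h2]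

end ClarkeCalculus

/-! ### Separation and multipliers. -/

section Multipliers

theorem sum_univ_eq_sum_coe {α M : Type*} [Fintype α] [AddCommMonoid M] (s : Finset α)
    (f : α → M) (f' : s → M) (h : ∀ j : s, f j = f' j) (h0 : ∀ j ∉ s, f j = 0) :
    ∑ j, f j = ∑ j, f' j := by
  rw [← Finset.sum_subset (Finset.subset_univ s) fun j _ hj => h0 j hj, ← Finset.sum_coe_sort s f]
  exact Finset.sum_congr rfl fun j _ => h j

/-- The convex combinations of points from finitely many convex sets, one from each. -/
def simplexCombinations {ι E : Type*} [Fintype ι] [AddCommGroup E] [Module ℝ E]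
    (s : ι → Set E) : Set E :=
  {x | ∃ ω ∈ stdSimplex ℝ ι, ∃ y : ι → E, (∀ i, y i ∈ s i) ∧ ∑ i, ω i • y i = x}

/-- For convex `s i`, the nonnegative multiples of `s i` add like their coefficients, so two
weighted points merge into one, with no case split on vanishing weights. -/
theorem convex_simplexCombinations {ι E : Type*} [Fintype ι] [AddCommGroup E] [Module ℝ E]
    {s : ι → Set E} (hs : ∀ i, Convex ℝ (s i)) : Convex ℝ (simplexCombinations s) := by
  rintro _ ⟨ω, hω, y, hy, rfl⟩ _ ⟨ω', hω', y', hy', rfl⟩ a b ha hb hab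
  have key : ∀ i, ∃ v ∈ s i,
      (a * ω i + b * ω' i) • v = (a * ω i) • y i + (b * ω' i) • y' i := by
    intro i
    have h : (a * ω i) • y i + (b * ω' i) • y' i ∈ (a * ω i + b * ω' i) • s i := by
      rw [(hs i).add_smul (mul_nonneg ha (hω.1 i)) (mul_nonneg hb (hω'.1 i))]
      exact Set.add_mem_add (Set.smul_mem_smul_set (hy i)) (Set.smul_mem_smul_set (hy' i))
    exact h
  choose v hv hv' using key
  refine ⟨a • ω + b • ω', convex_stdSimplex ℝ ι hω hω' ha hb hab, v, hv, ?_⟩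
  simp only [Pi.add_apply, Pi.smul_apply, smul_eq_mul, hv', Finset.sum_add_distrib,
    Finset.smul_sum, smul_smul]

theorem isCompact_simplexCombinations {ι E : Type*} [Fintype ι] [AddCommGroup E] [Module ℝ E]
    [TopologicalSpace E] [IsTopologicalAddGroup E] [ContinuousSMul ℝ E]
    {s : ι → Set E} (hs : ∀ i, IsCompact (s i)) : IsCompact (simplexCombinations s) := by
  have h : IsCompact ((fun q : (ι → ℝ) × (ι → E) => ∑ i, q.1 i • q.2 i) ''
      (stdSimplex ℝ ι ×ˢ Set.univ.pi s)) :=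
    ((isCompact_stdSimplex ℝ ι).prod (isCompact_univ_pi hs)).image (by fun_prop)
  convert h using 1
  ext x
  constructor
  · rintro ⟨ω, hω, y, hy, rfl⟩
    exact ⟨(ω, y), ⟨hω, fun i _ => hy i⟩, rfl⟩
  · rintro ⟨⟨ω, y⟩, ⟨hω, hy⟩, rfl⟩
    exact ⟨ω, hω, y, fun i => hy i trivial, rfl⟩

theorem subset_simplexCombinations {ι E : Type*} [Fintype ι] [AddCommGroup E] [Module ℝ E]
    {s : ι → Set E} (hs : ∀ i, (s i).Nonempty) (i : ι) : s i ⊆ simplexCombinations s := by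
  classical
  intro x hx
  choose y hy using hs
  refine ⟨Pi.single i 1, single_mem_stdSimplex ℝ i, Function.update y i x, fun j => ?_, ?_⟩
  · rcases eq_or_ne j i with rfl | hj
    · simpa using hx
    · simpa [hj] using hy j
  · rw [Finset.sum_eq_single i (fun j _ hj => by simp [hj]) (by simp)]
    simp

/-- If the shifted functions `ψ i + ⟪v i, ·⟫` have no common direction of negative Clarke
derivative at `z`, then some convex combination of their generalized gradients vanishes. -/
theorem exists_stdSimplex_clarkeGradient {n : ℕ} {ι : Type*} [Fintype ι] [Nonempty ι]
    {ψ : ι → EuclideanSpace ℝ (Fin n) → ℝ} (hψ : ∀ i, LocallyLipschitz (ψ i))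
    (z : EuclideanSpace ℝ (Fin n)) (v : ι → EuclideanSpace ℝ (Fin n))
    (h : ∀ w, ∃ i, 0 ≤ clarkeDeriv (ψ i) z w + inner ℝ (v i) w) :
    ∃ ω ∈ stdSimplex ℝ ι, ∃ ξ : ι → EuclideanSpace ℝ (Fin n),
      (∀ i, ξ i ∈ clarkeGradient (ψ i) z) ∧ ∑ i, ω i • (ξ i + v i) = 0 := by
  set s : ι → Set (EuclideanSpace ℝ (Fin n)) :=
    fun i => (fun ξ => ξ + v i) '' clarkeGradient (ψ i) z with hs
  by_cases h0 : (0 : EuclideanSpace ℝ (Fin n)) ∈ simplexCombinations s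
  · obtain ⟨ω, hω, y, hy, h0⟩ := h0
    choose ξ hξ hξy using hy
    refine ⟨ω, hω, ξ, hξ, ?_⟩
    rw [← h0]
    exact Finset.sum_congr rfl fun i _ => by rw [← hξy i]
  · exfalso
    have hconv : ∀ i, Convex ℝ (s i) := fun i => by
      have := (convex_clarkeGradient (ψ i) z).translate (v i)
      simpa only [hs, add_comm] using this
    have hcomp : ∀ i, IsCompact (s i) := fun i =>
      (isCompact_clarkeGradient (hψ i) z).image (by fun_prop)
    -- The vector w representing the separating functional would be a common descent direction: some
    -- ξ in each gradient attains ψ⁰(z; w), so ψ⁰(z; w) + ⟨v i, w⟩ = f (ξ + v i) < u < 0.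
    obtain ⟨f, u, hf, hu⟩ := geometric_hahn_banach_closed_point (convex_simplexCombinations hconv)
      (isCompact_simplexCombinations hcomp).isClosed h0
    rw [map_zero] at hu
    obtain ⟨i, hi⟩ := h ((InnerProductSpace.toDual ℝ _).symm f)
    obtain ⟨ξ, hξ, hξw⟩ := exists_mem_clarkeGradient_inner_eq (hψ i) z
      ((InnerProductSpace.toDual ℝ _).symm f)
    rw [← hξw, ← inner_add_left, real_inner_comm, InnerProductSpace.toDual_symm_apply] at hi
    have := hf _ (subset_simplexCombinations
      (fun i => (clarkeGradient_nonempty (hψ i) z).image _) i (Set.mem_image_of_mem _ hξ))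
    linarith

end Multipliers

/-! ### Centers and widths of interval-valued functions. -/

section IntervalFunctions

variable {n m : ℕ} {f : EuclideanSpace ℝ (Fin n) → NonemptyInterval ℝ}

theorem intervalNorm_gHDiff (Q R : NonemptyInterval ℝ) :
    intervalNorm (gHDiff Q R) = max |Q.fst - R.fst| |Q.snd - R.snd| := by
  simp only [intervalNorm, gHDiff]
  rcases le_total (Q.fst - R.fst) (Q.snd - R.snd) with h | h
  · rw [min_eq_left h, max_eq_right h]
  · rw [min_eq_right h, max_eq_left h, max_comm]

theorem abs_center_sub_le (Q R : NonemptyInterval ℝ) :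
    |center Q - center R| ≤ intervalNorm (gHDiff Q R) := by
  rw [intervalNorm_gHDiff]
  simp only [center]
  grind

theorem abs_width_sub_le (Q R : NonemptyInterval ℝ) :
    |width Q - width R| ≤ intervalNorm (gHDiff Q R) := by
  rw [intervalNorm_gHDiff]
  simp only [width]
  grind

theorem LocallyLipschitzIVF.comp (hf : LocallyLipschitzIVF f) {c : NonemptyInterval ℝ → ℝ}
    (hc : ∀ Q R, |c Q - c R| ≤ intervalNorm (gHDiff Q R)) :
    LocallyLipschitz (fun u => c (f u)) := by
  intro x
  obtain ⟨U, hU, L, hL, h⟩ := hf x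
  refine ⟨⟨L, hL.le⟩, U, hU, LipschitzOnWith.of_dist_le_mul fun a ha b hb => ?_⟩
  rw [Real.dist_eq, dist_eq_norm]
  exact (hc _ _).trans (h a ha b hb)

/-- The center functions and the width functions of a family of interval-valued functions. -/
noncomputable def centerWidth (F : Fin m → EuclideanSpace ℝ (Fin n) → NonemptyInterval ℝ) :
    Fin m ⊕ Fin m → EuclideanSpace ℝ (Fin n) → ℝ
  | .inl k => fun u => center (F k u)
  | .inr k => fun u => width (F k u)

theorem locallyLipschitz_centerWidth
    {F : Fin m → EuclideanSpace ℝ (Fin n) → NonemptyInterval ℝ}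
    (hF : ∀ k, LocallyLipschitzIVF (F k)) (i : Fin m ⊕ Fin m) :
    LocallyLipschitz (centerWidth F i) :=
  match i with
  | .inl k => (hF k).comp abs_center_sub_le
  | .inr k => (hF k).comp abs_width_sub_le

theorem strictCW_add_zeroTo_iff (Q R : NonemptyInterval ℝ) (e : ℝ≥0) :
    StrictCW (Q + zeroTo e) R ↔ center Q + e / 2 < center R ∧ width Q + e / 2 < width R := by
  simp only [StrictCW, center, width, zeroTo, NonemptyInterval.fst_add, NonemptyInterval.snd_add]
  constructor <;> rintro ⟨h1, h2⟩ <;> constructor <;> linarith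

theorem smul_add_smul_mem_smul_weakGradient {z ξ η : EuclideanSpace ℝ (Fin n)}
    (hξ : ξ ∈ clarkeGradient (fun u => center (f u)) z)
    (hη : η ∈ clarkeGradient (fun u => width (f u)) z) {a b : ℝ} (ha : 0 ≤ a) (hb : 0 ≤ b) :
    a • ξ + b • η ∈ (a + b) • weakGradient f z := by
  rw [weakGradient, (convex_convexHull ℝ _).add_smul ha hb]
  exact Set.add_mem_add (Set.smul_mem_smul_set (subset_convexHull ℝ _ (.inl hξ)))
    (Set.smul_mem_smul_set (subset_convexHull ℝ _ (.inr hη)))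

end IntervalFunctions

/-- A quadratic variational principle: an approximate minimizer of a function that is
nonnegative on a closed set has nearby a local minimizer of a quadratic perturbation. -/
theorem exists_local_min_add_sq {E : Type*} [NormedAddCommGroup E] [ProperSpace E]
    {S : Set E} (hS : IsClosed S) {φ : E → ℝ} (hφ : Continuous φ) (h0 : ∀ z ∈ S, 0 ≤ φ z)
    {a : E} (ha : a ∈ S) {e δ : ℝ} (hae : φ a ≤ e) (hδ : 0 < δ) :
    ∃ x ∈ S, ‖x - a‖ ≤ δ ∧ ∀ᶠ z in 𝓝 x, z ∈ S →
      φ x + e / δ ^ 2 * ‖x - a‖ ^ 2 ≤ φ z + e / δ ^ 2 * ‖z - a‖ ^ 2 := by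
  have hin : ∀ x, ‖x - a‖ < δ → ∀ᶠ z in 𝓝 x, z ∈ Metric.closedBall a δ := fun x hx =>
    mem_of_superset (Metric.isOpen_ball.mem_nhds (mem_ball_iff_norm.2 hx))
      Metric.ball_subset_closedBall
  obtain ⟨x, ⟨hxS, hxδ⟩, hx⟩ := ((isCompact_closedBall a δ).inter_left hS).exists_isMinOn
    ⟨a, ha, Metric.mem_closedBall_self hδ.le⟩
    (f := fun z => φ z + e / δ ^ 2 * ‖z - a‖ ^ 2) (by fun_prop)
  rw [isMinOn_iff] at hx
  rw [mem_closedBall_iff_norm] at hxδ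
  rcases hxδ.lt_or_eq with hlt | heq
  -- An interior minimizer over the ball is a local minimizer on S.
  · refine ⟨x, hxS, hxδ, ?_⟩
    filter_upwards [hin x hlt] with z hz hzS using hx z ⟨hzS, hz⟩
  -- On the sphere the penalty equals e, so the minimum is at least e ≥ φ a, and the center `a` is
  -- itself a minimizer.
  · refine ⟨a, ha, by simpa using hδ.le, ?_⟩
    filter_upwards [hin a (by simpa using hδ)] with z hz hzS
    refine le_trans ?_ (hx z ⟨hzS, hz⟩)
    simp only [heq, sub_self, norm_zero]
    rw [div_mul_cancel₀ _ (by positivity)]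
    have := h0 x hxS
    linarith

/-! ### Fritz John and KKT conditions. -/

section Optimality

variable {n m p : ℕ}

/-- Fritz John conditions for a perturbed problem. -/
theorem exists_no_common_descent
    {F : Fin m → EuclideanSpace ℝ (Fin n) → NonemptyInterval ℝ}
    {g : Fin p → EuclideanSpace ℝ (Fin n) → ℝ}
    (hF : ∀ k, LocallyLipschitzIVF (F k)) (hg : ∀ j, LocallyLipschitz (g j))
    {ε : Fin m → ℝ≥0} (hε : ε ≠ 0) {a : EuclideanSpace ℝ (Fin n)}
    (ha : a ∈ weakEpsMinimal F (feasibleSet g) ε) {δ : ℝ} (hδ : 0 < δ) :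
    ∃ x ∈ ballIn (feasibleSet g) a δ, ∃ v : EuclideanSpace ℝ (Fin n),
      ‖v‖ ≤ 1 / δ * ⨆ k, (ε k : ℝ) ∧ ∀ w,
        (∃ i, 0 ≤ clarkeDeriv (centerWidth F i) x w + inner ℝ v w) ∨
        (∃ j ∈ activeIndices g x, 0 ≤ clarkeDeriv (g j) x w) := by
  -- A nonzero ε supplies an index, so the maximum defining φ is over a nonempty set.
  obtain ⟨k₀, hk₀⟩ := Function.ne_iff.1 hε
  have hne : (Finset.univ : Finset (Fin m ⊕ Fin m)).Nonempty := ⟨.inl k₀, Finset.mem_univ _⟩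
  set e : ℝ := ⨆ k, (ε k : ℝ) with he
  have hle : ∀ k, (ε k : ℝ) ≤ e := le_ciSup (Set.finite_range _).bddAbove
  have he0 : 0 ≤ e := (ε k₀).2.trans (hle k₀)
  set d : Fin m ⊕ Fin m → ℝ := Sum.elim (fun k => (ε k : ℝ) / 2) (fun k => (ε k : ℝ) / 2) with hd
  have hde : ∀ i, d i ≤ e / 2 := by
    rintro (k | k) <;> simp only [hd, Sum.elim_inl, Sum.elim_inr] <;> linarith [hle k]
  set φ : EuclideanSpace ℝ (Fin n) → ℝ := fun z =>
    Finset.univ.sup' hne fun i => centerWidth F i z - centerWidth F i a + d i with hφ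
  have hφc : Continuous φ := Continuous.finset_sup'_apply hne fun i _ =>
    ((locallyLipschitz_centerWidth hF i).continuous.sub continuous_const).add continuous_const
  have hS : IsClosed (feasibleSet g) := by
    rw [feasibleSet, Set.ofPred_forall]
    exact isClosed_iInter fun j => isClosed_le (hg j).continuous continuous_const
  have h0 : ∀ z ∈ feasibleSet g, 0 ≤ φ z := by
    intro z hz
    by_contra! hneg
    refine ha.2 ⟨z, hz, fun k => ?_⟩
    rw [hφ, Finset.sup'_lt_iff] at hneg
    have h1 := hneg (.inl k) (Finset.mem_univ _)
    have h2 := hneg (.inr k) (Finset.mem_univ _)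
    simp only [hd, Sum.elim_inl, Sum.elim_inr, centerWidth] at h1 h2
    rw [strictCW_add_zeroTo_iff]
    constructor <;> linarith
  have hφa : φ a ≤ e / 2 := Finset.sup'_le _ _ fun i _ => by simpa using hde i
  obtain ⟨x, hxS, hxδ, hx⟩ := exists_local_min_add_sq hS hφc h0 ha.1 hφa hδ
  set κ : ℝ := e / 2 / δ ^ 2 with hκ
  refine ⟨x, ⟨hxS, hxδ⟩, (2 * κ) • (x - a), ?_, fun w => ?_⟩
  · rw [norm_smul, Real.norm_of_nonneg (by positivity)]
    calc 2 * κ * ‖x - a‖ ≤ 2 * κ * δ := by gcongr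
      _ = 1 / δ * e := by rw [hκ]; field_simp
  · by_contra! hcon
    obtain ⟨hh, hgw⟩ := hcon
    have hlim : Tendsto (fun t : ℝ => x + t • w) (𝓝[>] 0) (𝓝 x) := by
      have := (tendsto_add_smul x w).comp
        (tendsto_const_nhds.prodMk tendsto_id : Tendsto (fun t : ℝ => (x, t)) (𝓝[>] 0) _)
      exact this
    have e1 : ∀ᶠ t : ℝ in 𝓝[>] 0, ∀ i,
        centerWidth F i (x + t • w) + κ * ‖x + t • w - a‖ ^ 2
          < centerWidth F i x + κ * ‖x - a‖ ^ 2 :=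
      eventually_all.2 fun i => eventually_add_sq_lt (locallyLipschitz_centerWidth hF i) (hh i)
    have e2 : ∀ᶠ t : ℝ in 𝓝[>] 0, ∀ j, g j (x + t • w) < 0 := by
      refine eventually_all.2 fun j => ?_
      rcases (hxS j).lt_or_eq with hj | hj
      · exact (((hg j).continuous.tendsto x).comp hlim).eventually_lt_const hj
      -- With κ = 0 the penalized descent lemma is plain descent, from the value 0 of an active
      -- constraint.
      · have := eventually_add_sq_lt (hg j) (x := x) (w := w) (a := a) (κ := 0)
          (by simpa using hgw j (by simpa [activeIndices] using hj))
        simpa [hj] using this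
    obtain ⟨t, h1, h2, h3⟩ := (e1.and (e2.and (hlim.eventually hx))).exists
    have h4 := h3 fun j => (h2 j).le
    have h5 : φ (x + t • w) < φ x + κ * ‖x - a‖ ^ 2 - κ * ‖x + t • w - a‖ ^ 2 := by
      refine (Finset.sup'_lt_iff hne).2 fun i hi => ?_
      have h6 : centerWidth F i x - centerWidth F i a + d i ≤ φ x :=
        Finset.le_sup' (fun i => centerWidth F i x - centerWidth F i a + d i) hi
      linarith [h1 i]
    linarith

/-- Normalization of Fritz John multipliers under the basic constraint qualification. -/
theorem exists_kkt_of_fritzJohn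
    {F : Fin m → EuclideanSpace ℝ (Fin n) → NonemptyInterval ℝ}
    {g : Fin p → EuclideanSpace ℝ (Fin n) → ℝ}
    {x v : EuclideanSpace ℝ (Fin n)} (hBCQ : BCQ g x)
    {α β : Fin m → ℝ} {γ : Fin p → ℝ} (hα : ∀ k, 0 ≤ α k) (hβ : ∀ k, 0 ≤ β k)
    (hγ : ∀ j, 0 ≤ γ j) (hγ0 : ∀ j ∉ activeIndices g x, γ j = 0)
    (hsum : ∑ k, (α k + β k) + ∑ j, γ j = 1)
    {ξ η : Fin m → EuclideanSpace ℝ (Fin n)} {ζ : Fin p → EuclideanSpace ℝ (Fin n)}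
    (hξ : ∀ k, ξ k ∈ clarkeGradient (fun u => center (F k u)) x)
    (hη : ∀ k, η k ∈ clarkeGradient (fun u => width (F k u)) x)
    (hζ : ∀ j, ζ j ∈ clarkeGradient (g j) x)
    (hzero : ∑ k, (α k • (ξ k + v) + β k • (η k + v)) + ∑ j, γ j • ζ j = 0) :
    ∃ (lam : Fin m → ℝ) (mu : Fin p → ℝ),
      (∀ k, 0 ≤ lam k) ∧ (∀ j, 0 ≤ mu j) ∧ ∑ k, lam k = 1 ∧
      (∃ y ∈ ∑ k, lam k • weakGradient (F k) x,
        ∃ y' ∈ ∑ j ∈ activeIndices g x, mu j • clarkeGradient (g j) x, y + y' + v = 0) ∧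
      ∀ j, mu j * g j x = 0 := by
  set Λ : ℝ := ∑ k, (α k + β k) with hΛ
  have hab : ∀ k, 0 ≤ α k + β k := fun k => add_nonneg (hα k) (hβ k)
  have hΛ0 : 0 ≤ Λ := Finset.sum_nonneg fun k _ => hab k
  have hΛpos : 0 < Λ := by
    -- If Λ = 0, all objective terms vanish and γ alone violates BCQ.
    refine hΛ0.lt_of_ne' fun hz => hBCQ ⟨γ, ?_, hγ, hγ0, ?_⟩
    · rintro rfl
      simp [hz] at hsum
    · have hz' := (Finset.sum_eq_zero_iff_of_nonneg fun k _ => hab k).1 hz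
      have hk : ∀ k, α k • (ξ k + v) + β k • (η k + v) = 0 := fun k => by
        have h := hz' k (Finset.mem_univ k)
        have h1 : α k = 0 := by linarith [hα k, hβ k]
        have h2 : β k = 0 := by linarith [hα k, hβ k]
        rw [h1, h2, zero_smul, zero_smul, add_zero]
      rw [Finset.sum_eq_zero fun k _ => hk k, zero_add] at hzero
      rw [← hzero]
      exact Set.finsetSum_mem_finsetSum _ _ _ fun j _ => Set.smul_mem_smul_set (hζ j)
  refine ⟨fun k => Λ⁻¹ * α k + Λ⁻¹ * β k, fun j => Λ⁻¹ * γ j, fun k => ?_, fun j => ?_, ?_,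
    ⟨∑ k, ((Λ⁻¹ * α k) • ξ k + (Λ⁻¹ * β k) • η k), ?_,
      ∑ j ∈ activeIndices g x, (Λ⁻¹ * γ j) • ζ j, ?_, ?_⟩, fun j => ?_⟩
  · have := hα k
    have := hβ k
    positivity
  · have := hγ j
    positivity
  · simp only [← mul_add, ← Finset.mul_sum]
    exact inv_mul_cancel₀ hΛpos.ne'
  · refine Set.finsetSum_mem_finsetSum _ _ _ fun k _ => ?_
    exact smul_add_smul_mem_smul_weakGradient (hξ k) (hη k)
      (mul_nonneg (inv_nonneg.2 hΛ0) (hα k)) (mul_nonneg (inv_nonneg.2 hΛ0) (hβ k))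
  · exact Set.finsetSum_mem_finsetSum _ _ _ fun j _ => Set.smul_mem_smul_set (hζ j)
  · have hact : ∑ j ∈ activeIndices g x, (Λ⁻¹ * γ j) • ζ j = ∑ j, (Λ⁻¹ * γ j) • ζ j :=
      Finset.sum_subset (Finset.subset_univ _) fun j _ hj => by simp [hγ0 j hj]
    have hv : v = Λ⁻¹ • ∑ k, (α k + β k) • v := by
      rw [← Finset.sum_smul, smul_smul, inv_mul_cancel₀ hΛpos.ne', one_smul]
    have hsc : Λ⁻¹ • (∑ k, (α k • (ξ k + v) + β k • (η k + v)) + ∑ j, γ j • ζ j) = 0 := by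
      rw [hzero, smul_zero]
    rw [hact]
    nth_rewrite 1 [hv]
    rw [← hsc]
    simp only [Finset.smul_sum, smul_add, add_smul, smul_smul, Finset.sum_add_distrib]
    abel
  · by_cases hj : j ∈ activeIndices g x
    · rw [show g j x = 0 by simpa [activeIndices] using hj, mul_zero]
    · simp [hγ0 j hj]

end Optimality

end MIOP

theorem theorem4p1 {n m p : ℕ}
    (F : Fin m → EuclideanSpace ℝ (Fin n) → NonemptyInterval ℝ)
    (g : Fin p → EuclideanSpace ℝ (Fin n) → ℝ)
    (hF : ∀ k, MIOP.LocallyLipschitzIVF (F k))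
    (hg : ∀ j, LocallyLipschitz (g j))
    (ε : Fin m → ℝ≥0) (hε : ε ≠ 0)
    (ubar : EuclideanSpace ℝ (Fin n))
    (hubar : ubar ∈ MIOP.weakEpsMinimal F (MIOP.feasibleSet g) ε)
    (δ : ℝ) (hδ : 0 < δ)
    (hBCQ : ∀ u ∈ MIOP.ballIn (MIOP.feasibleSet g) ubar δ, MIOP.BCQ g u) :
    ∃ x ∈ MIOP.ballIn (MIOP.feasibleSet g) ubar δ,
      ∃ (lam : Fin m → ℝ) (mu : Fin p → ℝ),
        (∀ k, 0 ≤ lam k) ∧ (∀ j, 0 ≤ mu j) ∧ ∑ k, lam k = 1 ∧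
        (0 : EuclideanSpace ℝ (Fin n)) ∈
          ∑ k, lam k • MIOP.weakGradient (F k) x
            + ∑ j ∈ MIOP.activeIndices g x, mu j • MIOP.clarkeGradient (g j) x
            + ((1 / δ) * ⨆ k, (ε k : ℝ)) •
                Metric.closedBall (0 : EuclideanSpace ℝ (Fin n)) 1 ∧
        ∀ j, mu j * g j x = 0 := by
  classical
  obtain ⟨x, hx, v, hv, hw⟩ := MIOP.exists_no_common_descent hF hg hε hubar hδ
  obtain ⟨k₀, -⟩ := Function.ne_iff.1 hε
  have : Nonempty (Fin m ⊕ Fin m) := ⟨.inl k₀⟩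
  let A := {j // j ∈ MIOP.activeIndices g x}
  obtain ⟨ω, hω, ξ, hξ, hzero⟩ := MIOP.exists_stdSimplex_clarkeGradient
    (ι := (Fin m ⊕ Fin m) ⊕ A) (ψ := Sum.elim (MIOP.centerWidth F) fun j => g j.1)
    (by
      rintro (i | j)
      exacts [MIOP.locallyLipschitz_centerWidth hF i, hg j.1])
    x (Sum.elim (fun _ => v) fun _ => 0) (fun w => by
      rcases hw w with ⟨i, hi⟩ | ⟨j, hj, hjw⟩
      · exact ⟨.inl i, hi⟩
      · exact ⟨.inr ⟨j, hj⟩, by simpa using hjw⟩)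
  have hsum := hω.2
  simp only [Fintype.sum_sum_type, Sum.elim_inl, Sum.elim_inr, add_zero] at hzero hsum
  -- Arbitrary gradients fill the inactive slots, whose multiplier is 0.
  choose ζ hζ using fun j => MIOP.clarkeGradient_nonempty (hg j) x
  obtain ⟨lam, mu, hlam, hmu, hlam1, ⟨y, hy, y', hy', hyv⟩, hcs⟩ :=
    MIOP.exists_kkt_of_fritzJohn (F := F) (v := v) (hBCQ x hx)
      (α := fun k => ω (.inl (.inl k))) (β := fun k => ω (.inl (.inr k)))
      (γ := fun j => if h : j ∈ MIOP.activeIndices g x then ω (.inr ⟨j, h⟩) else 0)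
      (ξ := fun k => ξ (.inl (.inl k))) (η := fun k => ξ (.inl (.inr k)))
      (ζ := fun j => if h : j ∈ MIOP.activeIndices g x then ξ (.inr ⟨j, h⟩) else ζ j)
      (fun k => hω.1 _) (fun k => hω.1 _)
      (fun j => by
        split_ifs
        exacts [hω.1 _, le_rfl])
      (fun j hj => dif_neg hj)
      (by
        rw [Finset.sum_add_distrib, ← hsum]
        congr 1
        exact MIOP.sum_univ_eq_sum_coe _ _ _ (fun j => dif_pos j.2) fun j hj => dif_neg hj)
      (fun k => hξ (.inl (.inl k))) (fun k => hξ (.inl (.inr k)))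
      (fun j => by
        split_ifs with h
        exacts [hξ (.inr ⟨j, h⟩), hζ j])
      (by
        rw [Finset.sum_add_distrib, ← hzero]
        congr 1
        exact MIOP.sum_univ_eq_sum_coe _ _ _ (fun j => by simp [A]) fun j hj => by simp [hj])
  refine ⟨x, hx, lam, mu, hlam, hmu, hlam1, ?_, hcs⟩
  have hvB : v ∈ ((1 / δ) * ⨆ k, (ε k : ℝ)) •
      Metric.closedBall (0 : EuclideanSpace ℝ (Fin n)) 1 := by
    rw [smul_unitClosedBall, mem_closedBall_zero_iff]
    exact hv.trans (le_abs_self _)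
  have h := Set.add_mem_add (Set.add_mem_add hy hy') hvB
  rwa [hyv] at h
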